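/- \textbf{Late change.} Let $N=2^m$ with $m\ge 1$, let $T$ be a multiple of $N\log N$, and let all logarithms have base $2$. Beams $1,\dots,N$ are sampled in the slots $1,\dots,T$, one beam per slot. Beam $i$ has mean $\mu_i$ and variance $v_i$. After a random slot $t_{\rm c}\in\{0,\dots,T\}$ of arbitrary distribution, the mean and variance of one beam $j$ change to $\mu_j^+$ and $v_j^+$. Given $t_{\rm c}$, the rewards are independent Gaussian variables with the means and variances in force in their slots. Beam $j$ is the $K$-th best beam before the change ($1\le K\le N$), i.e. exactly $K-1$ beams have a mean larger than the original mean of $j$, and it is the unique best beam after the change. Let $\Delta_{\min}$ be the minimum difference between the means of two different beams, over all pairs of beams, before and after the change. Let $V>0$ be such that the variances of any two different beams, before or after the change, add up to at most $V$ (for instance $V=2\sigma_{\max}^2$ if all variances are at most $\sigma^2_{\max}$). Sequential halving has $\log N$ rounds of $T/\log N$ slots each. In round $r$ the $N/2^{r-1}$ surviving beams are sampled in round-robin order, each $n_r=\frac{2^{r-1}T}{N\log N}$ times, and the half of them with the larger sample means in this round survives. Let $r_{\rm c}$ be the round that contains slot $t_{\rm c}$ ($r_{\rm c}=1$ if $t_{\rm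 c}=0$), and let $r^*=\lfloor\log\frac{N}{2K}\rfloor+1$. If the change occurs after the first $\log\frac{N}{2K}$ rounds with positive probability, then the conditional probability that sequential halving does not return beam $j$ satisfies \[ \mathbb{P}\Big(\text{error}\;\Big|\;r_{\rm c}>\log\tfrac{N}{2K}\Big)\;\le\;\mathcal{T}_1(r_{\rm c})+2\log(2NK)\,\exp\!\Big(-\frac12\,\frac{\Delta_{\min}^2}{V}\,\frac{T}{N\log N}\Big), \] where \[ \mathcal{T}_1(r_{\rm c})=\mathbb{E}\big[r_{\rm c}-r^*\;\big|\;r^*\le r_{\rm c}\le\log N\big]. \] In units in which $V=1$, the exponential is $\exp\big(-\Delta_{\min}^2T/(2N\log N)\big)$. -/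

import Mathlib

open MeasureTheory ProbabilityTheory Finset
open scoped NNReal ENNReal

/-! ## Sequential halving with round-robin sampling

There are `N` beams, `T` time slots `1, …, T`, and `Nat.log 2 N` rounds of equal length; `N` is a
power of two. A table `x` of rewards gives the value `x i t` that is observed if beam `i` is
activated in slot `t`. -/

namespace SeqHalving

/-- Number of slots of one round, `T / log₂ N`. -/
def roundLength (N T : ℕ) : ℕ := T / Nat.log 2 N

/-- Number `n_r = 2^(r-1) T / (N log₂ N)` of times that each surviving beam is sampled in
round `r = 1, 2, …`. -/
def numSamples (N T r : ℕ) : ℕ := 2 ^ (r - 1) * T / (N * Nat.log 2 N)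

/-- The slot in which beam `i ∈ S` is sampled for the `(k+1)`-st time in round `r`, when the set
of beams `S` enters round `r` and these beams are sampled cyclically, in increasing order. -/
def slot {N : ℕ} (T r : ℕ) (S : Finset (Fin N)) (i : Fin N) (k : ℕ) : ℕ :=
  (r - 1) * roundLength N T + k * #S + #{a ∈ S | a < i} + 1

/-- Empirical mean of beam `i` in round `r`, when the set of beams `S` enters round `r`. -/
noncomputable def empMean {N : ℕ} (T r : ℕ) (x : Fin N → ℕ → ℝ) (S : Finset (Fin N))
    (i : Fin N) : ℝ :=
  (∑ k ∈ range (numSamples N T r), x i (slot T r S i k)) / (numSamples N T r : ℝ)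

/-- Beam `a` is ranked above beam `b`: larger estimate, ties broken by the smaller index. -/
def RankedAbove {N : ℕ} (est : Fin N → ℝ) (a b : Fin N) : Prop :=
  est b < est a ∨ (est a = est b ∧ a < b)

open Classical in
/-- The better half of `S` according to the estimates `est`. -/
noncomputable def topHalf {N : ℕ} (S : Finset (Fin N)) (est : Fin N → ℝ) : Finset (Fin N) :=
  {i ∈ S | 2 * #{a ∈ S | RankedAbove est a i} < #S}

/-- The set of beams that are left after `r` rounds (so it enters round `r + 1`). -/
noncomputable def survivors {N : ℕ} (T : ℕ) (x : Fin N → ℕ → ℝ) : ℕ → Finset (Fin N)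
  | 0 => univ
  | r + 1 => topHalf (survivors T x r) (empMean T (r + 1) x (survivors T x r))

/-- Sequential halving does not return beam `j`. -/
def Fails {N : ℕ} (T : ℕ) (x : Fin N → ℕ → ℝ) (j : Fin N) : Prop :=
  survivors T x (Nat.log 2 N) ≠ {j}

/-! ## Single abrupt change -/

/-- The round that contains slot `s`, i.e. the `r ≥ 1` with
`(r-1) · roundLength < s ≤ r · roundLength`; the value at `s = 0` is `1`. -/
def roundOf (N T s : ℕ) : ℕ := (s - 1) / roundLength N T + 1

/-- `r* = log₂ (N / (2K)) + 1`, with the logarithm rounded down if it is not an integer. -/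
noncomputable def rStar (N K : ℕ) : ℤ := ⌊Real.logb 2 ((N : ℝ) / (2 * K))⌋ + 1

/-- Minimum difference between the means of two different beams, before the change (means `μ`)
and after it (means `μ'`). -/
noncomputable def deltaMin {N : ℕ} (μ μ' : Fin N → ℝ) : ℝ :=
  ⨅ p : {p : Fin N × Fin N // p.1 ≠ p.2},
    min |μ p.1.1 - μ p.1.2| |μ' p.1.1 - μ' p.1.2|

/-- The law of the change slot `tc` is arbitrary on `{0, …, T}`. Given `tc = s`, the rewards
`R i t` of the beams in the slots `1, …, T` are independent Gaussian variables, with mean `μ i` and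
variance `v i` if `t ≤ s`, and with mean `μ' i` and variance `v' i` if `t > s`. -/
structure IsAbruptGaussian {Ω : Type*} [MeasurableSpace Ω] (P : Measure Ω) {N : ℕ} (T : ℕ)
    (μ μ' : Fin N → ℝ) (v v' : Fin N → ℝ≥0) (tc : Ω → ℕ) (R : Fin N → ℕ → Ω → ℝ) : Prop where
  measurable_tc : Measurable tc
  tc_le : ∀ ω, tc ω ≤ T
  measurable_reward : ∀ i, ∀ t ∈ Icc 1 T, Measurable (R i t)
  indep : ∀ s, P (tc ⁻¹' {s}) ≠ 0 →
    iIndepFun (fun (p : Fin N × Icc 1 T) => R p.1 p.2.1) (P[|tc ⁻¹' {s}])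
  law : ∀ s, P (tc ⁻¹' {s}) ≠ 0 → ∀ i, ∀ t ∈ Icc 1 T,
    (P[|tc ⁻¹' {s}]).map (R i t) =
      if t ≤ s then gaussianReal (μ i) (v i) else gaussianReal (μ' i) (v' i)

end SeqHalving

/-! Round `r*` is the last one whose surviving half still has room for `K` beams. Given `r_c ≥ r*`,
the excess `r_c - r*` is a nonnegative integer, so Markov's inequality
(`measureReal_ne_le_integral`) bounds the probability of `r_c ≠ r*` by its mean. This is the whole
first term.

Let `r_c = r*` and fix the change slot. Up to round `r*`, beam `j` can only drop out if it fails to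
beat some beam outside the `K - 1` initially better ones; later, it must fail to beat some beam, all
of which are now worse. Either way the rival is worse by at least `Δ` throughout the round, even if
the change occurs in its middle. A Chernoff bound (`measureReal_sum_le_sum_le`) with at least `n = T
/ (N log N)` samples gives `exp (-gap² n / (2V))`. The gaps of different rivals are `Δ`-separated,
so the union bound over them is a geometric series (`sum_exp_neg_sq_le`): it costs a factor 2, not
the number of rivals, once `E = exp (-Δ² n / (2V)) ≤ 1/2`. The random set entering a round is
independent of the rewards in it, so it may be treated as fixed (`measureReal_exists_survivors_le`).
Summing over `log N ≤ log (2NK)` rounds gives the second term; if `E > 1/2`, that term exceeds 1. -/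

namespace SeqHalving

/-! ### Ranking and the better half -/

section Ranking

variable {N : ℕ}

theorem RankedAbove.irrefl (est : Fin N → ℝ) (a : Fin N) : ¬ RankedAbove est a a := by
  simp [RankedAbove]

theorem RankedAbove.trans {est : Fin N → ℝ} {a b c : Fin N} (hab : RankedAbove est a b)
    (hbc : RankedAbove est b c) : RankedAbove est a c := by
  unfold RankedAbove at *
  rcases hab with h | ⟨h, h'⟩ <;> rcases hbc with g | ⟨g, g'⟩
  · exact .inl (g.trans h)
  · exact .inl (g ▸ h)
  · exact .inl (h ▸ g)
  · exact .inr ⟨h.trans g, h'.trans g'⟩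

theorem RankedAbove.total {est : Fin N → ℝ} {a b : Fin N} (hab : a ≠ b) :
    RankedAbove est a b ∨ RankedAbove est b a := by
  unfold RankedAbove
  rcases lt_trichotomy (est a) (est b) with h | h | h
  · exact .inr (.inl h)
  · rcases lt_or_gt_of_ne hab with g | g
    · exact .inl (.inr ⟨h, g⟩)
    · exact .inr (.inr ⟨h.symm, g⟩)
  · exact .inl (.inl h)

open Classical in
/-- Position of `i` in the ranking of `S`, starting with `0`. -/
noncomputable def rank (S : Finset (Fin N)) (est : Fin N → ℝ) (i : Fin N) : ℕ :=
  #{a ∈ S | RankedAbove est a i}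

theorem mem_topHalf {S : Finset (Fin N)} {est : Fin N → ℝ} {i : Fin N} :
    i ∈ topHalf S est ↔ i ∈ S ∧ 2 * rank S est i < #S := by
  simp [topHalf, rank]

theorem rank_lt_rank {S : Finset (Fin N)} {est : Fin N → ℝ} {a b : Fin N} (ha : a ∈ S)
    (hab : RankedAbove est a b) : rank S est a < rank S est b := by
  classical
  refine card_lt_card ⟨fun c hc => ?_, fun h => ?_⟩
  · rw [mem_filter] at hc ⊢
    exact ⟨hc.1, hc.2.trans hab⟩
  · exact RankedAbove.irrefl est a (mem_filter.1 (h (mem_filter.2 ⟨ha, hab⟩))).2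

theorem rank_injOn (S : Finset (Fin N)) (est : Fin N → ℝ) : Set.InjOn (rank S est) S := by
  intro a ha b hb h
  by_contra hab
  rcases RankedAbove.total (est := est) hab with g | g
  · exact (rank_lt_rank ha g).ne h
  · exact (rank_lt_rank hb g).ne' h

theorem rank_lt_card {S : Finset (Fin N)} {est : Fin N → ℝ} {i : Fin N} (hi : i ∈ S) :
    rank S est i < #S := by
  classical
  exact card_lt_card (filter_ssubset.2 ⟨i, hi, RankedAbove.irrefl est i⟩)

/-- Tie-breaking makes the order total, so ranks are distinct; hence exactly `h` of `2 * h` beams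
have rank below `h`. -/
theorem image_rank (S : Finset (Fin N)) (est : Fin N → ℝ) :
    S.image (rank S est) = range #S := by
  refine eq_of_subset_of_card_le (fun k hk => ?_) ?_
  · obtain ⟨i, hi, rfl⟩ := mem_image.1 hk
    exact mem_range.2 (rank_lt_card hi)
  · rw [card_range, card_image_of_injOn (rank_injOn S est)]

theorem card_topHalf {S : Finset (Fin N)} {h : ℕ} (hS : #S = 2 * h) (est : Fin N → ℝ) :
    #(topHalf S est) = h := by
  have hsub : topHalf S est ⊆ S := fun i hi => (mem_topHalf.1 hi).1
  rw [← card_image_of_injOn ((rank_injOn S est).mono (coe_subset.2 hsub))]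
  suffices (topHalf S est).image (rank S est) = range h by rw [this, card_range]
  ext k
  simp only [mem_image, mem_topHalf, mem_range]
  constructor
  · rintro ⟨i, ⟨-, hi⟩, rfl⟩
    omega
  · intro hk
    have : k ∈ S.image (rank S est) := by rw [image_rank, mem_range]; omega
    obtain ⟨i, hi, rfl⟩ := mem_image.1 this
    exact ⟨i, ⟨hi, by omega⟩, rfl⟩

theorem topHalf_congr {S : Finset (Fin N)} {est est' : Fin N → ℝ}
    (h : ∀ i ∈ S, est i = est' i) : topHalf S est = topHalf S est' := by
  classical
  ext i
  rw [mem_topHalf, mem_topHalf]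
  refine and_congr_right fun hi => ?_
  have : rank S est i = rank S est' i := by
    unfold rank
    congr 1
    refine filter_congr fun a ha => ?_
    rw [RankedAbove, RankedAbove, h i hi, h a ha]
  rw [this]

/-- A beam stays among the better half if it beats all beams outside a set that is smaller than
the better half. -/
theorem mem_topHalf_of_beats {S : Finset (Fin N)} {h : ℕ} (hS : #S = 2 * h) {est : Fin N → ℝ}
    {j : Fin N} (hj : j ∈ S) {B : Finset (Fin N)} (hB : #B < h)
    (hbeat : ∀ i ∈ S, i ≠ j → i ∉ B → est i < est j) : j ∈ topHalf S est := by
  classical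
  refine mem_topHalf.2 ⟨hj, ?_⟩
  -- Only beams of `B` can rank above `j`: the others lose strictly, so ties do not matter.
  have : rank S est j ≤ #B := by
    refine card_le_card fun i hi => ?_
    obtain ⟨hiS, hij⟩ := mem_filter.1 hi
    by_contra hiB
    rcases eq_or_ne i j with rfl | hne
    · exact RankedAbove.irrefl est i hij
    · have := hbeat i hiS hne hiB
      rcases hij with g | ⟨g, -⟩ <;> linarith
  omega

theorem measurable_rank {α : Type*} [MeasurableSpace α] {f : α → Fin N → ℝ} (hf : Measurable f)
    (S : Finset (Fin N)) (i : Fin N) : Measurable fun x => rank S (f x) i := by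
  classical
  have hfi : ∀ a, Measurable fun x => f x a := fun a => (measurable_pi_apply a).comp hf
  unfold rank
  simp_rw [card_filter]
  refine Finset.measurable_sum _ fun a _ => Measurable.ite ?_ measurable_const measurable_const
  simp only [RankedAbove]
  refine (measurableSet_lt (hfi i) (hfi a)).union
    ((measurableSet_eq_fun (hfi a) (hfi i)).inter (MeasurableSet.const _))

theorem measurableSet_topHalf_eq {α : Type*} [MeasurableSpace α] {f : α → Fin N → ℝ}
    (hf : Measurable f) (S S' : Finset (Fin N)) : MeasurableSet {x | topHalf S (f x) = S'} := by
  have : {x | topHalf S (f x) = S'} =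
      ⋂ i, {x | (i ∈ S ∧ 2 * rank S (f x) i < #S) ↔ i ∈ S'} := by
    ext x
    simp [Finset.ext_iff, mem_topHalf]
  rw [this]
  refine MeasurableSet.iInter fun i => ?_
  have hr : MeasurableSet {x | 2 * rank S (f x) i < #S} :=
    measurableSet_lt ((measurable_rank hf S i).const_mul 2) measurable_const
  exact ((MeasurableSet.const (i ∈ S)).inter hr).iff (MeasurableSet.const (i ∈ S'))

end Ranking

/-! ### Slots of a round and dependence on past rewards -/

section Schedule

variable {m n : ℕ}

theorem roundLength_eq (hm : 1 ≤ m) : roundLength (2 ^ m) (2 ^ m * m * n) = 2 ^ m * n := by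
  rw [roundLength, Nat.log_pow (by norm_num), mul_right_comm, Nat.mul_div_cancel _ hm]

theorem numSamples_succ (hm : 1 ≤ m) (q : ℕ) :
    numSamples (2 ^ m) (2 ^ m * m * n) (q + 1) = 2 ^ q * n := by
  rw [numSamples, Nat.log_pow (by norm_num), Nat.add_sub_cancel,
    show 2 ^ q * (2 ^ m * m * n) = 2 ^ q * n * (2 ^ m * m) by ring]
  exact Nat.mul_div_cancel _ (by positivity)

theorem card_survivors {T : ℕ} (x : Fin (2 ^ m) → ℕ → ℝ) {q : ℕ} (hq : q ≤ m) :
    #(survivors T x q) = 2 ^ (m - q) := by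
  induction q with
  | zero => simp [survivors]
  | succ q ih =>
    refine card_topHalf ?_ _
    rw [ih (by omega), ← pow_succ']
    congr 1
    omega

/-- With `q` counted from 0, `2 ^ q * n` cycles through `2 ^ (m - q)` beams fill the `2 ^ m * n`
slots of the round exactly. -/
theorem slot_mem_Ioc (hm : 1 ≤ m) {q : ℕ} (hq : q < m) {S : Finset (Fin (2 ^ m))}
    (hS : #S = 2 ^ (m - q)) {i : Fin (2 ^ m)} (hi : i ∈ S) {k : ℕ} (hk : k < 2 ^ q * n) :
    slot (2 ^ m * m * n) (q + 1) S i k ∈ Ioc (q * (2 ^ m * n)) ((q + 1) * (2 ^ m * n)) := by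
  rw [slot, roundLength_eq hm, Nat.add_sub_cancel, mem_Ioc]
  have h1 : #{a ∈ S | a < i} < #S := card_lt_card (filter_ssubset.2 ⟨i, hi, lt_irrefl i⟩)
  have h2 : (k + 1) * #S ≤ 2 ^ m * n := by
    calc (k + 1) * #S ≤ 2 ^ q * n * #S := Nat.mul_le_mul_right _ hk
      _ = 2 ^ q * 2 ^ (m - q) * n := by rw [hS]; ring
      _ = 2 ^ m * n := by rw [← pow_add]; congr 2; omega
  constructor
  · omega
  · nlinarith

theorem Ioc_subset_Icc {q : ℕ} (hq : q < m) :
    Ioc (q * (2 ^ m * n)) ((q + 1) * (2 ^ m * n)) ⊆ Icc 1 (2 ^ m * m * n) := by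
  intro t ht
  rw [mem_Ioc] at ht
  rw [mem_Icc]
  refine ⟨by omega, ht.2.trans ?_⟩
  calc (q + 1) * (2 ^ m * n) ≤ m * (2 ^ m * n) := Nat.mul_le_mul_right _ hq
    _ = _ := by ring

theorem slot_injective {N T r : ℕ} {S : Finset (Fin N)} {i : Fin N} (hi : i ∈ S) :
    Function.Injective (slot T r S i) := by
  intro k l h
  have : 0 < #S := card_pos.2 ⟨i, hi⟩
  simp only [slot] at h
  exact Nat.eq_of_mul_eq_mul_right this (by omega)

theorem empMean_congr (hm : 1 ≤ m) {q : ℕ} (hq : q < m) {S : Finset (Fin (2 ^ m))}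
    (hS : #S = 2 ^ (m - q)) {x y : Fin (2 ^ m) → ℕ → ℝ}
    (hxy : ∀ i, ∀ t ∈ Ioc (q * (2 ^ m * n)) ((q + 1) * (2 ^ m * n)), x i t = y i t)
    {i : Fin (2 ^ m)} (hi : i ∈ S) :
    empMean (2 ^ m * m * n) (q + 1) x S i = empMean (2 ^ m * m * n) (q + 1) y S i := by
  rw [empMean, empMean, numSamples_succ hm]
  congr 1
  exact sum_congr rfl fun k hk => hxy i _ (slot_mem_Ioc hm hq hS hi (mem_range.1 hk))

/-- Survival depends on past slots only; this is the source of the independence between rounds. -/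
theorem survivors_congr (hm : 1 ≤ m) {q : ℕ} (hq : q ≤ m) {x y : Fin (2 ^ m) → ℕ → ℝ}
    (hxy : ∀ i, ∀ t ∈ Ioc 0 (q * (2 ^ m * n)), x i t = y i t) :
    survivors (2 ^ m * m * n) x q = survivors (2 ^ m * m * n) y q := by
  induction q with
  | zero => rfl
  | succ q ih =>
    have hle : q * (2 ^ m * n) ≤ (q + 1) * (2 ^ m * n) := Nat.mul_le_mul_right _ (by omega)
    have hS := ih (by omega) fun i t ht => hxy i t (Ioc_subset_Ioc_right hle ht)
    rw [survivors, survivors, ← hS]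
    exact topHalf_congr fun i hi => empMean_congr hm (by omega) (card_survivors x (by omega))
      (fun i t ht => hxy i t (Ioc_subset_Ioc_left (Nat.zero_le _) ht)) hi

theorem measurable_empMean {N T r : ℕ} (S : Finset (Fin N)) :
    Measurable fun x : Fin N → ℕ → ℝ => empMean T r x S := by
  refine measurable_pi_lambda _ fun i => ?_
  unfold empMean
  refine Measurable.div_const (Finset.measurable_sum _ fun k _ => ?_) _
  fun_prop

theorem measurableSet_survivors_eq {N T : ℕ} (q : ℕ) (S : Finset (Fin N)) :
    MeasurableSet {x : Fin N → ℕ → ℝ | survivors T x q = S} := by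
  induction q generalizing S with
  | zero => simp [survivors]
  | succ q ih =>
    have : {x : Fin N → ℕ → ℝ | survivors T x (q + 1) = S} =
        ⋃ S', {x | survivors T x q = S'} ∩ {x | topHalf S' (empMean T (q + 1) x S') = S} := by
      ext x
      simp [survivors]
    rw [this]
    exact MeasurableSet.iUnion fun S' =>
      (ih S').inter (measurableSet_topHalf_eq (measurable_empMean S') S' S)

end Schedule

/-! ### Chernoff bound for two Gaussian samples -/

section Gaussian

variable {Ω : Type*} [MeasurableSpace Ω] {Q : Measure Ω}

theorem hasSubgaussianMGF_sub_of_map_eq_gaussianReal {X : Ω → ℝ} {a : ℝ} {u : ℝ≥0}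
    (hX : Measurable X) (h : Q.map X = gaussianReal a u) :
    HasSubgaussianMGF (fun ω => X ω - a) u Q := by
  have hY : Q.map (fun ω => X ω - a) = gaussianReal 0 u := by
    have : Q.map (fun ω => X ω - a) = (Q.map X).map (fun y => y - a) :=
      (Measure.map_map (g := fun y : ℝ => y - a) (by fun_prop) hX).symm
    rw [this, h, gaussianReal_map_sub_const, sub_self]
  rw [← HasSubgaussianMGF.id_map_iff (by fun_prop), hY]
  refine ⟨fun t => integrable_exp_mul_gaussianReal t, fun t => ?_⟩
  rw [mgf_gaussianReal (μ := 0) (v := u) (by simp)]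
  simp

theorem HasSubgaussianMGF.mono {X : Ω → ℝ} {c d : ℝ≥0} (h : HasSubgaussianMGF X c Q)
    (hcd : c ≤ d) : HasSubgaussianMGF X d Q :=
  ⟨h.integrable_exp_mul, fun t => (h.mgf_le t).trans (by gcongr)⟩

/-- Probability that a Gaussian sample with the smaller means has the larger sum. -/
theorem measureReal_sum_le_sum_le {n : ℕ} {X Y : Fin n → Ω → ℝ}
    (hindep : iIndepFun (Sum.elim X Y) Q)
    (hX : ∀ k, Measurable (X k)) (hY : ∀ k, Measurable (Y k)) {a b : Fin n → ℝ}
    {u w : Fin n → ℝ≥0} (hXlaw : ∀ k, Q.map (X k) = gaussianReal (a k) (u k))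
    (hYlaw : ∀ k, Q.map (Y k) = gaussianReal (b k) (w k)) {g V : ℝ} (hg : 0 ≤ g) (hV : 0 < V)
    (hgap : ∀ k, g ≤ b k - a k) (hvar : ∀ k, (u k : ℝ) + w k ≤ V) :
    Q.real {ω | ∑ k, Y k ω ≤ ∑ k, X k ω} ≤ Real.exp (-(g ^ 2 * n / (2 * V))) := by
  have : IsProbabilityMeasure Q := hindep.isProbabilityMeasure
  have hcomp := hindep.comp (Sum.elim (fun k x => x - a k) (fun k x => -(x - b k)))
    (by rintro (k | k) <;> simp only [Sum.elim_inl, Sum.elim_inr] <;> fun_prop)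
  have hsub : ∀ p ∈ (univ : Finset (Fin n ⊕ Fin n)),
      HasSubgaussianMGF (Sum.elim (fun k x => x - a k) (fun k x => -(x - b k)) p ∘ Sum.elim X Y p)
        (Sum.elim u w p) Q := by
    rintro (k | k) -
    · exact hasSubgaussianMGF_sub_of_map_eq_gaussianReal (hX k) (hXlaw k)
    · exact (hasSubgaussianMGF_sub_of_map_eq_gaussianReal (hY k) (hYlaw k)).neg
  have hsum := HasSubgaussianMGF.sum_of_iIndepFun hcomp hsub
  -- Only sums of variances of two beams are bounded, so the `k`-th samples of both are paired.
  have hc : ∑ p, Sum.elim u w p ≤ n * V.toNNReal := by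
    rw [Fintype.sum_sum_type, ← sum_add_distrib]
    calc _ ≤ ∑ _k : Fin n, V.toNNReal := by
          refine sum_le_sum fun k _ => ?_
          rw [Real.le_toNNReal_iff_coe_le hV.le]
          exact_mod_cast hvar k
      _ = _ := by simp
  have key := (HasSubgaussianMGF.mono hsum hc).measure_ge_le (ε := n * g) (by positivity)
  refine (measureReal_mono fun ω hω => ?_).trans (key.trans (Real.exp_le_exp.2 (le_of_eq ?_)))
  · simp only [Set.mem_ofPred_eq, Fintype.sum_sum_type, Sum.elim_inl, Sum.elim_inr,
      Function.comp_apply] at hω ⊢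
    rw [sum_neg_distrib, sum_sub_distrib, sum_sub_distrib]
    have : ∑ _k : Fin n, g ≤ ∑ k, (b k - a k) := sum_le_sum fun k _ => hgap k
    rw [sum_sub_distrib] at this
    simp only [sum_const, card_univ, Fintype.card_fin, nsmul_eq_mul] at this
    linarith
  · rw [NNReal.coe_mul, Real.coe_toNNReal _ hV.le]
    rcases Nat.eq_zero_or_pos n with rfl | hn
    · simp
    · have : (n : ℝ) ≠ 0 := by positivity
      simp only [NNReal.coe_natCast]
      field_simp

end Gaussian

/-! ### Union bound over separated gaps -/

section GapSum

/-- Gaussian tails at `Δ`-separated gaps are dominated by a geometric series. -/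
theorem sum_exp_neg_sq_le {ι : Type*} (s : Finset ι) {gap : ι → ℝ} {Δ c : ℝ} (hΔ : 0 < Δ)
    (hc : 0 ≤ c) (hgap : ∀ i ∈ s, Δ ≤ gap i)
    (hsep : ∀ i ∈ s, ∀ k ∈ s, i ≠ k → Δ ≤ |gap i - gap k|)
    (hE : Real.exp (-(Δ ^ 2 * c)) ≤ 1 / 2) :
    ∑ i ∈ s, Real.exp (-(gap i ^ 2 * c)) ≤ 2 * Real.exp (-(Δ ^ 2 * c)) := by
  classical
  set E := Real.exp (-(Δ ^ 2 * c)) with hEdef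
  have hE0 : 0 < E := Real.exp_pos _
  -- Gaps with the same integer part in units of `Δ` would be closer than `Δ`. These parts are at
  -- least 1, so the truncated shift stays injective.
  have hinj : Set.InjOn (fun i => ⌊gap i / Δ⌋₊ - 1) s := by
    intro i hi k hk h
    by_contra hne
    have h1 : 1 ≤ ⌊gap i / Δ⌋₊ := Nat.le_floor (by
      rw [Nat.cast_one, le_div_iff₀ hΔ, one_mul]; exact hgap i hi)
    have h2 : 1 ≤ ⌊gap k / Δ⌋₊ := Nat.le_floor (by
      rw [Nat.cast_one, le_div_iff₀ hΔ, one_mul]; exact hgap k hk)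
    have h3 : ⌊gap i / Δ⌋₊ = ⌊gap k / Δ⌋₊ := by simp only at h; omega
    have hpi : 0 ≤ gap i / Δ := div_nonneg (hΔ.le.trans (hgap i hi)) hΔ.le
    have hpk : 0 ≤ gap k / Δ := div_nonneg (hΔ.le.trans (hgap k hk)) hΔ.le
    have a1 := Nat.floor_le hpi
    have a2 := Nat.lt_floor_add_one (gap i / Δ)
    have a3 := Nat.floor_le hpk
    have a4 := Nat.lt_floor_add_one (gap k / Δ)
    rw [h3] at a1 a2
    have : |gap i / Δ - gap k / Δ| < 1 := abs_lt.2 ⟨by linarith, by linarith⟩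
    rw [← sub_div, abs_div, abs_of_pos hΔ, div_lt_one hΔ] at this
    exact absurd (hsep i hi k hk hne) (not_le.2 this)
  -- For `k = ⌊gap i / Δ⌋₊ ≥ 1`, the squared gap is at least `k² Δ² ≥ k Δ²`.
  have hterm : ∀ i ∈ s, Real.exp (-(gap i ^ 2 * c)) ≤ E * E ^ (⌊gap i / Δ⌋₊ - 1) := by
    intro i hi
    have h1 : 1 ≤ ⌊gap i / Δ⌋₊ := Nat.le_floor (by
      rw [Nat.cast_one, le_div_iff₀ hΔ, one_mul]; exact hgap i hi)
    have hpi : 0 ≤ gap i / Δ := div_nonneg (hΔ.le.trans (hgap i hi)) hΔ.le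
    have a1 := Nat.floor_le hpi
    rw [← pow_succ', Nat.sub_add_cancel h1, hEdef, ← Real.exp_nat_mul]
    refine Real.exp_le_exp.2 ?_
    rw [mul_neg, neg_le_neg_iff, ← mul_assoc]
    refine mul_le_mul_of_nonneg_right ?_ hc
    rw [le_div_iff₀ hΔ] at a1
    have h1' : (1 : ℝ) ≤ ⌊gap i / Δ⌋₊ := by exact_mod_cast h1
    have : ((⌊gap i / Δ⌋₊ : ℝ) * Δ) ^ 2 ≤ gap i ^ 2 := by gcongr
    nlinarith [sq_nonneg Δ]
  calc ∑ i ∈ s, Real.exp (-(gap i ^ 2 * c)) ≤ ∑ i ∈ s, E * E ^ (⌊gap i / Δ⌋₊ - 1) :=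
        sum_le_sum hterm
    _ = E * ∑ k ∈ s.image (fun i => ⌊gap i / Δ⌋₊ - 1), E ^ k := by
        rw [sum_image hinj, mul_sum]
    _ ≤ E * ∑' k : ℕ, E ^ k := by
        gcongr
        exact (summable_geometric_of_lt_one hE0.le (by linarith)).sum_le_tsum _
          fun k _ => by positivity
    _ ≤ 2 * E := by
        rw [tsum_geometric_of_lt_one hE0.le (by linarith), mul_comm]
        gcongr
        rw [inv_le_comm₀ (by linarith) (by norm_num)]
        linarith

end GapSum

/-! ### Reward tables with finitely many cells -/

section Table

variable {N T : ℕ}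

/-- The table of rewards with the given entries in the cells of `I` and zeros elsewhere. -/
noncomputable def extendTable (I : Finset (Fin N × Icc 1 T)) (g : I → ℝ) (i : Fin N) (t : ℕ) : ℝ :=
  if h : ∃ ht : t ∈ Icc 1 T, (i, ⟨t, ht⟩) ∈ I then g ⟨(i, ⟨t, h.1⟩), h.2⟩ else 0

/-- Events about whole tables become events about finitely many rewards; outside slots `1, …, T` no
measurability is assumed. -/
theorem measurable_extendTable (I : Finset (Fin N × Icc 1 T)) : Measurable (extendTable I) := by
  refine measurable_pi_lambda _ fun i => measurable_pi_lambda _ fun t => ?_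
  unfold extendTable
  split_ifs with h
  · exact measurable_pi_apply _
  · exact measurable_const

theorem extendTable_restrict (I : Finset (Fin N × Icc 1 T)) (x : Fin N → ℕ → ℝ) {i : Fin N} {t : ℕ}
    (ht : t ∈ Icc 1 T) (hI : (i, ⟨t, ht⟩) ∈ I) :
    extendTable I (fun p => x p.1.1 p.1.2.1) i t = x i t := by
  rw [extendTable, dif_pos ⟨ht, hI⟩]

end Table

/-! ### Elimination probability in one round -/

section Rounds

variable {Ω : Type*} [MeasurableSpace Ω] {Q : Measure Ω} {m n : ℕ}
  {R : Fin (2 ^ m) → ℕ → Ω → ℝ}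

/-- The set entering a round is independent of an event about the rewards of that round. -/
theorem measureReal_survivors_inter (hm : 1 ≤ m)
    (hmeas : ∀ i, ∀ t ∈ Icc 1 (2 ^ m * m * n), Measurable (R i t))
    (hindep : iIndepFun (fun p : Fin (2 ^ m) × Icc 1 (2 ^ m * m * n) => R p.1 p.2.1) Q)
    {q : ℕ} (hq : q < m) (S : Finset (Fin (2 ^ m))) {A : Set (Fin (2 ^ m) → ℕ → ℝ)}
    (hA : MeasurableSet A)
    (hAround : ∀ x y : Fin (2 ^ m) → ℕ → ℝ,
      (∀ i, ∀ t ∈ Ioc (q * (2 ^ m * n)) ((q + 1) * (2 ^ m * n)), x i t = y i t) →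
        (x ∈ A ↔ y ∈ A)) :
    Q.real ({ω | survivors (2 ^ m * m * n) (fun i t => R i t ω) q = S} ∩
        {ω | (fun i t => R i t ω) ∈ A}) =
      Q.real {ω | survivors (2 ^ m * m * n) (fun i t => R i t ω) q = S} *
        Q.real {ω | (fun i t => R i t ω) ∈ A} := by
  classical
  -- Past cells `I` determine the entering set, later cells `J` the event; they are disjoint.
  set I : Finset (Fin (2 ^ m) × Icc 1 (2 ^ m * m * n)) := {p | p.2.1 ≤ q * (2 ^ m * n)} with hI
  set J : Finset (Fin (2 ^ m) × Icc 1 (2 ^ m * m * n)) := {p | ¬ p.2.1 ≤ q * (2 ^ m * n)} with hJ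
  have hind := hindep.indepFun_finset I J (disjoint_filter_filter_not _ _ _)
    fun p => hmeas p.1 p.2.1 p.2.2
  have e1 : {ω | survivors (2 ^ m * m * n) (fun i t => R i t ω) q = S} =
      (fun ω (p : I) => R p.1.1 p.1.2.1 ω) ⁻¹'
        (extendTable I ⁻¹' {x | survivors (2 ^ m * m * n) x q = S}) := by
    ext ω
    simp only [Set.mem_ofPred_eq, Set.mem_preimage]
    rw [survivors_congr hm hq.le]
    intro i t ht
    have ht' : t ∈ Icc 1 (2 ^ m * m * n) := by
      rw [mem_Ioc] at ht
      rw [mem_Icc]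
      refine ⟨ht.1, ht.2.trans ?_⟩
      calc q * (2 ^ m * n) ≤ m * (2 ^ m * n) := Nat.mul_le_mul_right _ hq.le
        _ = _ := by ring
    exact (extendTable_restrict I (fun i t => R i t ω) ht'
      (by simp [hI, (mem_Ioc.1 ht).2])).symm
  have e2 : {ω | (fun i t => R i t ω) ∈ A} =
      (fun ω (p : J) => R p.1.1 p.1.2.1 ω) ⁻¹' (extendTable J ⁻¹' A) := by
    ext ω
    simp only [Set.mem_ofPred_eq, Set.mem_preimage]
    refine hAround _ _ fun i t ht => ?_
    exact (extendTable_restrict J (fun i t => R i t ω) (Ioc_subset_Icc hq ht)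
      (by simp [hJ, (mem_Ioc.1 ht).1])).symm
  rw [e1, e2, Measure.real, Measure.real, Measure.real, ← ENNReal.toReal_mul,
    hind.measure_inter_preimage_eq_mul _ _
      (measurable_extendTable I (measurableSet_survivors_eq q S)) (measurable_extendTable J hA)]

theorem measurableSet_survivors_process_eq (hm : 1 ≤ m)
    (hmeas : ∀ i, ∀ t ∈ Icc 1 (2 ^ m * m * n), Measurable (R i t)) {q : ℕ} (hq : q ≤ m)
    (S : Finset (Fin (2 ^ m))) :
    MeasurableSet {ω | survivors (2 ^ m * m * n) (fun i t => R i t ω) q = S} := by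
  have hext : Measurable fun ω => extendTable (univ : Finset (Fin (2 ^ m) × Icc 1 (2 ^ m * m * n)))
      (fun p => R p.1.1 p.1.2.1 ω) :=
    (measurable_extendTable _).comp (measurable_pi_lambda _ fun p => hmeas _ _ p.1.2.2)
  convert! hext (measurableSet_survivors_eq q S) using 1
  ext ω
  simp only [Set.mem_ofPred_eq, Set.mem_preimage]
  rw [survivors_congr hm hq]
  intro i t ht
  have ht' : t ∈ Icc 1 (2 ^ m * m * n) := by
    rw [mem_Ioc] at ht
    rw [mem_Icc]
    refine ⟨ht.1, ht.2.trans ?_⟩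
    calc q * (2 ^ m * n) ≤ m * (2 ^ m * n) := Nat.mul_le_mul_right _ hq
      _ = _ := by ring
  exact (extendTable_restrict univ (fun i t => R i t ω) ht' (mem_univ _)).symm

/-- If, for every possible set `S`, an event about one round has probability at most `δ`, then so
it has for the random set that enters this round. -/
theorem measureReal_exists_survivors_le (hm : 1 ≤ m)
    (hmeas : ∀ i, ∀ t ∈ Icc 1 (2 ^ m * m * n), Measurable (R i t))
    (hindep : iIndepFun (fun p : Fin (2 ^ m) × Icc 1 (2 ^ m * m * n) => R p.1 p.2.1) Q)
    {q : ℕ} (hq : q < m) (A : Finset (Fin (2 ^ m)) → Set (Fin (2 ^ m) → ℕ → ℝ))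
    (hA : ∀ S, MeasurableSet (A S)) {δ : ℝ} (hδ : 0 ≤ δ)
    (hAround : ∀ S, #S = 2 ^ (m - q) → ∀ x y : Fin (2 ^ m) → ℕ → ℝ,
      (∀ i, ∀ t ∈ Ioc (q * (2 ^ m * n)) ((q + 1) * (2 ^ m * n)), x i t = y i t) →
        (x ∈ A S ↔ y ∈ A S))
    (hbound : ∀ S, #S = 2 ^ (m - q) → Q.real {ω | (fun i t => R i t ω) ∈ A S} ≤ δ) :
    Q.real {ω | (fun i t => R i t ω) ∈ A (survivors (2 ^ m * m * n) (fun i t => R i t ω) q)} ≤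
      δ := by
  classical
  have : IsProbabilityMeasure Q := hindep.isProbabilityMeasure
  set F : Finset (Fin (2 ^ m)) → Set Ω := fun S =>
    {ω | survivors (2 ^ m * m * n) (fun i t => R i t ω) q = S} with hF
  set C : Finset (Finset (Fin (2 ^ m))) := {S | #S = 2 ^ (m - q)} with hC
  have hsub : {ω | (fun i t => R i t ω) ∈ A (survivors (2 ^ m * m * n) (fun i t => R i t ω) q)} ⊆
      ⋃ S ∈ C, F S ∩ {ω | (fun i t => R i t ω) ∈ A S} := by
    intro ω hω
    simp only [Set.mem_iUnion]
    exact ⟨_, by simp [hC, card_survivors _ hq.le], rfl, hω⟩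
  calc _ ≤ Q.real (⋃ S ∈ C, F S ∩ {ω | (fun i t => R i t ω) ∈ A S}) := measureReal_mono hsub (measure_ne_top _ _)
    _ ≤ ∑ S ∈ C, Q.real (F S ∩ {ω | (fun i t => R i t ω) ∈ A S}) :=
        measureReal_biUnion_finset_le _ _
    _ ≤ ∑ S ∈ C, Q.real (F S) * δ := by
        refine sum_le_sum fun S hS => ?_
        have hS' : #S = 2 ^ (m - q) := by simpa [hC] using hS
        rw [measureReal_survivors_inter hm hmeas hindep hq S (hA S) (hAround S hS')]
        exact mul_le_mul_of_nonneg_left (hbound S hS') measureReal_nonneg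
    -- The events of different entering sets are disjoint, so the number of sets does not enter the
    -- bound.
    _ = Q.real (⋃ S ∈ C, F S) * δ := by
        rw [← sum_mul, measureReal_biUnion_finset]
        · intro S _ S' _ hne
          exact Set.disjoint_left.2 fun ω h h' => hne (h.symm.trans h')
        · exact fun S _ => measurableSet_survivors_process_eq hm hmeas hq.le S
    _ ≤ 1 * δ := mul_le_mul_of_nonneg_right measureReal_le_one hδ
    _ = δ := one_mul δ

variable {M : Fin (2 ^ m) → ℕ → ℝ} {W : Fin (2 ^ m) → ℕ → ℝ≥0} {V : ℝ}

/-- Probability that, in one round with a given set of beams, a worse beam looks better. -/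
theorem measureReal_empMean_le_empMean_le (hm : 1 ≤ m) (hn : 1 ≤ n)
    (hmeas : ∀ i, ∀ t ∈ Icc 1 (2 ^ m * m * n), Measurable (R i t))
    (hindep : iIndepFun (fun p : Fin (2 ^ m) × Icc 1 (2 ^ m * m * n) => R p.1 p.2.1) Q)
    (hlaw : ∀ i, ∀ t ∈ Icc 1 (2 ^ m * m * n), Q.map (R i t) = gaussianReal (M i t) (W i t))
    {q : ℕ} (hq : q < m) {S : Finset (Fin (2 ^ m))} (hS : #S = 2 ^ (m - q))
    {i j : Fin (2 ^ m)} (hij : i ≠ j) (hi : i ∈ S) (hj : j ∈ S) (hV : 0 < V)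
    (hvar : ∀ t t', (W i t : ℝ) + W j t' ≤ V) {g : ℝ} (hg : 0 ≤ g)
    (hgap : ∀ t ∈ Ioc (q * (2 ^ m * n)) ((q + 1) * (2 ^ m * n)),
      ∀ t' ∈ Ioc (q * (2 ^ m * n)) ((q + 1) * (2 ^ m * n)), g ≤ M j t' - M i t) :
    Q.real {ω | empMean (2 ^ m * m * n) (q + 1) (fun i t => R i t ω) S j ≤
        empMean (2 ^ m * m * n) (q + 1) (fun i t => R i t ω) S i} ≤
      Real.exp (-(g ^ 2 * (n / (2 * V)))) := by
  have : IsProbabilityMeasure Q := hindep.isProbabilityMeasure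
  set s : Fin (2 ^ m) → Fin (2 ^ q * n) → ℕ := fun a k =>
    slot (2 ^ m * m * n) (q + 1) S a k with hs
  have hround : ∀ a ∈ S, ∀ k, s a k ∈ Ioc (q * (2 ^ m * n)) ((q + 1) * (2 ^ m * n)) :=
    fun a ha k => slot_mem_Ioc hm hq hS ha k.2
  have hIcc : ∀ a ∈ S, ∀ k, s a k ∈ Icc 1 (2 ^ m * m * n) :=
    fun a ha k => Ioc_subset_Icc hq (hround a ha k)
  have hsinj : ∀ a ∈ S, Function.Injective (s a) :=
    fun a ha k l h => Fin.ext (slot_injective ha h)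
  have hinj : Function.Injective (Sum.elim
      (fun k => ((i, ⟨s i k, hIcc i hi k⟩) : Fin (2 ^ m) × Icc 1 (2 ^ m * m * n)))
      (fun k => (j, ⟨s j k, hIcc j hj k⟩))) := by
    rintro (k | k) (l | l) h <;> simp only [Sum.elim_inl, Sum.elim_inr, Prod.mk.injEq,
      Subtype.mk.injEq] at h
    · exact congrArg _ (hsinj i hi h.2)
    · exact absurd h.1 hij
    · exact absurd h.1.symm hij
    · exact congrArg _ (hsinj j hj h.2)
  have hind : iIndepFun (Sum.elim (fun k => R i (s i k)) (fun k => R j (s j k))) Q := by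
    convert! hindep.precomp hinj using 1
    ext (k | k) <;> rfl
  have key := measureReal_sum_le_sum_le hind (fun k => hmeas i _ (hIcc i hi k))
    (fun k => hmeas j _ (hIcc j hj k)) (fun k => hlaw i _ (hIcc i hi k))
    (fun k => hlaw j _ (hIcc j hj k)) hg hV
    (fun k => hgap _ (hround i hi k) _ (hround j hj k)) (fun k => hvar _ _)
  have hpos : (0 : ℝ) < ((2 ^ q * n : ℕ) : ℝ) := by positivity
  refine (measureReal_mono fun ω hω => ?_).trans (key.trans (Real.exp_le_exp.2 ?_))
  · simp only [Set.mem_ofPred_eq, empMean, numSamples_succ hm] at hω ⊢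
    rw [div_le_div_iff_of_pos_right hpos, sum_range, sum_range] at hω
    exact hω
  -- The round has `2 ^ q * n ≥ n` samples per beam; the gain in later rounds is given away.
  · rw [neg_le_neg_iff, mul_div_assoc]
    gcongr
    exact Nat.le_mul_of_pos_left _ (by positivity)

/-- Probability that beam `j` is eliminated in a round. The beams of `B` may be better than `j`;
in this round beam `j` has a mean of at least `M₀`, and the means `ν` of the remaining beams are
smaller and separated. -/
theorem measureReal_eliminated_le (hm : 1 ≤ m) (hn : 1 ≤ n)
    (hmeas : ∀ i, ∀ t ∈ Icc 1 (2 ^ m * m * n), Measurable (R i t))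
    (hindep : iIndepFun (fun p : Fin (2 ^ m) × Icc 1 (2 ^ m * m * n) => R p.1 p.2.1) Q)
    (hlaw : ∀ i, ∀ t ∈ Icc 1 (2 ^ m * m * n), Q.map (R i t) = gaussianReal (M i t) (W i t))
    {q : ℕ} (hq : q < m) {j : Fin (2 ^ m)} (hV : 0 < V)
    (hvar : ∀ i, i ≠ j → ∀ t t', (W i t : ℝ) + W j t' ≤ V)
    {B : Finset (Fin (2 ^ m))} (hB : #B < 2 ^ (m - (q + 1))) {ν : Fin (2 ^ m) → ℝ} {M₀ Δ : ℝ}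
    (hMj : ∀ t ∈ Ioc (q * (2 ^ m * n)) ((q + 1) * (2 ^ m * n)), M₀ ≤ M j t)
    (hMi : ∀ i, i ≠ j → ∀ t, M i t = ν i) (hΔ : 0 < Δ)
    (hgap : ∀ i, i ≠ j → i ∉ B → Δ ≤ M₀ - ν i)
    (hsep : ∀ i k, i ≠ k → i ≠ j → k ≠ j → Δ ≤ |ν i - ν k|)
    (hE : Real.exp (-(Δ ^ 2 * (n / (2 * V)))) ≤ 1 / 2) :
    Q.real {ω | j ∈ survivors (2 ^ m * m * n) (fun i t => R i t ω) q ∧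
        j ∉ survivors (2 ^ m * m * n) (fun i t => R i t ω) (q + 1)} ≤
      2 * Real.exp (-(Δ ^ 2 * (n / (2 * V)))) := by
  classical
  have : IsProbabilityMeasure Q := hindep.isProbabilityMeasure
  -- Ties count as losses here, so the complement yields the strict wins that keep `j` in the half.
  set A : Finset (Fin (2 ^ m)) → Set (Fin (2 ^ m) → ℕ → ℝ) := fun S =>
    {x | j ∈ S ∧ ∃ i ∈ {i ∈ S | i ≠ j ∧ i ∉ B},
      empMean (2 ^ m * m * n) (q + 1) x S j ≤ empMean (2 ^ m * m * n) (q + 1) x S i} with hAdef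
  have hA : ∀ S, MeasurableSet (A S) := by
    intro S
    have hmean := fun i => (measurable_pi_apply i).comp
      (measurable_empMean (N := 2 ^ m) (T := 2 ^ m * m * n) (r := q + 1) S)
    have : A S = {_x | j ∈ S} ∩ ⋃ i ∈ ({i ∈ S | i ≠ j ∧ i ∉ B} : Finset _),
        {x | empMean (2 ^ m * m * n) (q + 1) x S j ≤ empMean (2 ^ m * m * n) (q + 1) x S i} := by
      ext x
      simp only [hAdef, Set.mem_ofPred_eq, Set.mem_inter_iff, Set.mem_iUnion, exists_prop]
    rw [this]
    exact (MeasurableSet.const _).inter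
      (Finset.measurableSet_biUnion _ fun i _ => measurableSet_le (hmean j) (hmean i))
  refine (measureReal_mono fun ω hω => ?_).trans
    (measureReal_exists_survivors_le hm hmeas hindep hq A hA (by positivity) ?_ ?_)
  · refine ⟨hω.1, ?_⟩
    by_contra hcon
    push Not at hcon
    refine hω.2 (mem_topHalf_of_beats (h := 2 ^ (m - (q + 1))) ?_ hω.1 hB fun i hi hne hiB =>
      hcon i (mem_filter.2 ⟨hi, hne, hiB⟩))
    rw [card_survivors _ hq.le, ← pow_succ']
    congr 1
    omega
  · intro S hS x y hxy
    simp only [hAdef, Set.mem_ofPred_eq]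
    refine and_congr_right fun hj => exists_congr fun i => and_congr_right fun hi => ?_
    rw [empMean_congr hm hq hS hxy hj, empMean_congr hm hq hS hxy (mem_filter.1 hi).1]
  · intro S hS
    by_cases hj : j ∈ S
    swap
    · have hempty : {ω | (fun i t => R i t ω) ∈ A S} = ∅ := by
        ext ω
        simp [hAdef, hj]
      rw [hempty, measureReal_empty]
      positivity
    calc _ ≤ Q.real (⋃ i ∈ ({i ∈ S | i ≠ j ∧ i ∉ B} : Finset _),
          {ω | empMean (2 ^ m * m * n) (q + 1) (fun i t => R i t ω) S j ≤
            empMean (2 ^ m * m * n) (q + 1) (fun i t => R i t ω) S i}) := by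
          refine measureReal_mono (fun ω hω => ?_) (measure_ne_top _ _)
          obtain ⟨-, i, hi, h⟩ := hω
          exact Set.mem_biUnion hi h
      _ ≤ _ := measureReal_biUnion_finset_le _ _
      _ ≤ ∑ i ∈ ({i ∈ S | i ≠ j ∧ i ∉ B} : Finset _),
          Real.exp (-((M₀ - ν i) ^ 2 * (n / (2 * V)))) := by
          refine sum_le_sum fun i hi => ?_
          obtain ⟨hiS, hne, hiB⟩ := mem_filter.1 hi
          refine measureReal_empMean_le_empMean_le hm hn hmeas hindep hlaw hq hS hne hiS hj hV
            (hvar i hne) (hΔ.le.trans (hgap i hne hiB)) fun t _ t' ht' => ?_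
          rw [hMi i hne]
          exact sub_le_sub_right (hMj t' ht') _
      _ ≤ _ := by
          refine sum_exp_neg_sq_le _ hΔ (by positivity) (fun i hi => ?_) (fun i hi k hk hik => ?_) hE
          · obtain ⟨-, hne, hiB⟩ := mem_filter.1 hi
            exact hgap i hne hiB
          · rw [sub_sub_sub_cancel_left, abs_sub_comm]
            exact hsep i k hik (mem_filter.1 hi).2.1 (mem_filter.1 hk).2.1

/-- Beam `j` is returned if it survives every round. -/
theorem measureReal_fails_le [IsProbabilityMeasure Q] {T : ℕ} (j : Fin (2 ^ m)) {δ : ℝ}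
    (h : ∀ q < m, Q.real {ω | j ∈ survivors T (fun i t => R i t ω) q ∧
      j ∉ survivors T (fun i t => R i t ω) (q + 1)} ≤ δ) :
    Q.real {ω | Fails T (fun i t => R i t ω) j} ≤ m * δ := by
  calc _ ≤ Q.real (⋃ q ∈ range m, {ω | j ∈ survivors T (fun i t => R i t ω) q ∧
      j ∉ survivors T (fun i t => R i t ω) (q + 1)}) := by
        refine measureReal_mono (fun ω hω => ?_) (measure_ne_top _ _)
        by_contra hcon
        simp only [Set.mem_iUnion, Set.mem_ofPred_eq, mem_range, exists_prop, not_exists, not_and,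
          not_not] at hcon
        have hmem : ∀ q ≤ m, j ∈ survivors T (fun i t => R i t ω) q := by
          intro q hq
          induction q with
          | zero => exact mem_univ _
          | succ q ih => exact hcon q hq (ih (by omega))
        refine hω ?_
        rw [Nat.log_pow (by norm_num)]
        refine (eq_of_subset_of_card_le (singleton_subset_iff.2 (hmem m le_rfl)) ?_).symm
        rw [card_survivors _ le_rfl, Nat.sub_self, pow_zero, card_singleton]
    _ ≤ ∑ q ∈ range m, Q.real {ω | j ∈ survivors T (fun i t => R i t ω) q ∧
      j ∉ survivors T (fun i t => R i t ω) (q + 1)} := measureReal_biUnion_finset_le _ _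
    _ ≤ ∑ _q ∈ range m, δ := sum_le_sum fun q hq => h q (mem_range.1 hq)
    _ = m * δ := by simp

end Rounds

/-! ### The critical round and conditioning on the change slot -/

section Change

theorem deltaMin_le {N : ℕ} (μ μ' : Fin N → ℝ) {i k : Fin N} (hik : i ≠ k) :
    deltaMin μ μ' ≤ |μ i - μ k| ∧ deltaMin μ μ' ≤ |μ' i - μ' k| := by
  have h : deltaMin μ μ' ≤ min |μ i - μ k| |μ' i - μ' k| :=
    ciInf_le (f := fun p : {p : Fin N × Fin N // p.1 ≠ p.2} =>
      min |μ p.1.1 - μ p.1.2| |μ' p.1.1 - μ' p.1.2|) (Set.finite_range _).bddBelow ⟨(i, k), hik⟩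
  exact ⟨h.trans (min_le_left _ _), h.trans (min_le_right _ _)⟩

theorem deltaMin_nonneg {N : ℕ} (μ μ' : Fin N → ℝ) : 0 ≤ deltaMin μ μ' :=
  Real.iInf_nonneg fun _ => le_min (abs_nonneg _) (abs_nonneg _)

theorem roundOf_eq {m n s : ℕ} (hm : 1 ≤ m) :
    roundOf (2 ^ m) (2 ^ m * m * n) s = (s - 1) / (2 ^ m * n) + 1 := by
  rw [roundOf, roundLength_eq hm]

theorem roundOf_le {m n s : ℕ} (hm : 1 ≤ m) (hs : s ≤ 2 ^ m * m * n) :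
    roundOf (2 ^ m) (2 ^ m * m * n) s ≤ m := by
  rw [roundOf_eq hm]
  rcases Nat.eq_zero_or_pos n with rfl | hn
  -- With rounds of length 0, division by zero puts every slot in round 1.
  · simpa using hm
  · refine (Nat.div_lt_iff_lt_mul (by positivity)).2 ?_
    have : 0 < 2 ^ m * m * n := by positivity
    calc s - 1 < 2 ^ m * m * n := by omega
      _ = m * (2 ^ m * n) := by ring

/-- The floor gives `2 ^ r ≤ N / (2K)`, so `K` beams still fit after `r + 1` rounds. -/
theorem le_two_pow_of_rStar_eq {m K r : ℕ} (hK : 1 ≤ K)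
    (hr : rStar (2 ^ m) K = ((r + 1 : ℕ) : ℤ)) : r < m ∧ K ≤ 2 ^ (m - (r + 1)) := by
  have hfloor : ⌊Real.logb 2 (((2 ^ m : ℕ) : ℝ) / (2 * K))⌋ = (r : ℤ) := by
    rw [rStar] at hr
    push_cast at hr ⊢
    linarith
  have hK' : (0 : ℝ) < K := by exact_mod_cast hK
  have h := Int.floor_le (Real.logb 2 (((2 ^ m : ℕ) : ℝ) / (2 * K)))
  rw [hfloor, Int.cast_natCast, Real.le_logb_iff_rpow_le (by norm_num) (by positivity),
    Real.rpow_natCast, le_div_iff₀ (by positivity)] at h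
  have h' : 2 ^ (r + 1) * K ≤ 2 ^ m := by
    rw [pow_succ, mul_assoc]
    exact_mod_cast h
  have hlt : r < m := by
    have : 2 ^ (r + 1) ≤ 2 ^ m := (Nat.le_mul_of_pos_right _ hK).trans h'
    exact (Nat.pow_le_pow_iff_right (by norm_num)).1 this
  refine ⟨hlt, le_of_mul_le_mul_left ?_ (Nat.two_pow_pos (r + 1))⟩
  rwa [← pow_add, Nat.add_sub_cancel' hlt]

variable {Ω : Type*} [MeasurableSpace Ω] {P : Measure Ω} {m n : ℕ}

/-- Error probability, given that the change happens in slot `s` of the critical round. -/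
theorem measureReal_cond_fails_le [IsProbabilityMeasure P] (hm : 1 ≤ m)
    {μ : Fin (2 ^ m) → ℝ} {v : Fin (2 ^ m) → ℝ≥0} {j : Fin (2 ^ m)} {μplus : ℝ} {vplus : ℝ≥0}
    (hbest : ∀ i, i ≠ j → μ i < μplus) {V : ℝ} (hV : 0 < V)
    (hvar : ∀ i i', i ≠ i' → (v i : ℝ) + v i' ≤ V) (hvarplus : ∀ i, i ≠ j → (v i : ℝ) + vplus ≤ V)
    {tc : Ω → ℕ} {R : Fin (2 ^ m) → ℕ → Ω → ℝ}
    (hmodel : IsAbruptGaussian P (2 ^ m * m * n) μ (Function.update μ j μplus)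
      v (Function.update v j vplus) tc R) {s : ℕ} (hs : P (tc ⁻¹' {s}) ≠ 0)
    (hround : (roundOf (2 ^ m) (2 ^ m * m * n) s : ℤ) = rStar (2 ^ m) (#{i | μ j < μ i} + 1))
    (hE : Real.exp (-(deltaMin μ (Function.update μ j μplus) ^ 2 * (n / (2 * V)))) ≤ 1 / 2) :
    (P[|tc ⁻¹' {s}]).real {ω | Fails (2 ^ m * m * n) (fun i t => R i t ω) j} ≤
      m * (2 * Real.exp (-(deltaMin μ (Function.update μ j μplus) ^ 2 * (n / (2 * V))))) := by
  set Δ := deltaMin μ (Function.update μ j μplus) with hΔdef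
  have hΔ0 : 0 ≤ Δ := deltaMin_nonneg _ _
  -- If `Δ` or `n` were 0, the exponential would be 1, contradicting `hE`.
  have hΔn : 0 < Δ ∧ 1 ≤ n := by
    constructor
    · refine lt_of_le_of_ne hΔ0 fun h => ?_
      rw [← h] at hE
      norm_num at hE
    · by_contra h
      have : n = 0 := by omega
      rw [this] at hE
      norm_num at hE
  obtain ⟨hΔ, hn⟩ := hΔn
  have hL : 0 < 2 ^ m * n := by positivity
  set q₀ := (s - 1) / (2 ^ m * n) with hq₀
  obtain ⟨hq₀m, hK⟩ := le_two_pow_of_rStar_eq (m := m) (r := q₀) (Nat.le_add_left 1 _)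
    (by rw [← hround, roundOf_eq hm])
  have hlow : q₀ * (2 ^ m * n) ≤ s - 1 := Nat.div_mul_le_self _ _
  have hupp : s - 1 < (q₀ + 1) * (2 ^ m * n) := Nat.lt_mul_of_div_lt (Nat.lt_succ_self _) hL
  have : IsProbabilityMeasure (P[|tc ⁻¹' {s}]) := cond_isProbabilityMeasure hs
  set M : Fin (2 ^ m) → ℕ → ℝ := fun i t =>
    if t ≤ s then μ i else Function.update μ j μplus i with hM
  set W : Fin (2 ^ m) → ℕ → ℝ≥0 := fun i t =>
    if t ≤ s then v i else Function.update v j vplus i with hW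
  have hlaw : ∀ i, ∀ t ∈ Icc 1 (2 ^ m * m * n),
      (P[|tc ⁻¹' {s}]).map (R i t) = gaussianReal (M i t) (W i t) := by
    intro i t ht
    rw [hmodel.law s hs i t ht, hM, hW]
    dsimp only
    split_ifs <;> rfl
  have hWV : ∀ i, i ≠ j → ∀ t t', (W i t : ℝ) + W j t' ≤ V := by
    intro i hi t t'
    simp only [hW, Function.update_of_ne hi, Function.update_self, ite_self]
    split_ifs
    · exact hvar i j hi
    · exact hvarplus i hi
  have hMi : ∀ i, i ≠ j → ∀ t, M i t = μ i := by
    intro i hi t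
    simp only [hM, Function.update_of_ne hi, ite_self]
  have hsep : ∀ i k, i ≠ k → i ≠ j → k ≠ j → Δ ≤ |μ i - μ k| :=
    fun i k hik _ _ => (deltaMin_le _ _ hik).1
  have hgap : ∀ i, i ≠ j → i ∉ ({i | μ j < μ i} : Finset _) → Δ ≤ μ j - μ i := by
    intro i hi hiB
    have h := (deltaMin_le μ (Function.update μ j μplus) hi.symm).1
    simp only [mem_filter, mem_univ, true_and, not_lt] at hiB
    rwa [abs_of_nonneg (sub_nonneg.2 hiB)] at h
  have hgap' : ∀ i, i ≠ j → Δ ≤ μplus - μ i := by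
    intro i hi
    have h := (deltaMin_le μ (Function.update μ j μplus) hi.symm).2
    rwa [Function.update_self, Function.update_of_ne hi,
      abs_of_pos (sub_pos.2 (hbest i hi))] at h
  refine measureReal_fails_le j fun q hq => ?_
  rcases lt_trichotomy q q₀ with hlt | heq | hgt
  · refine measureReal_eliminated_le hm hn hmodel.measurable_reward (hmodel.indep s hs) hlaw hq hV
      hWV (B := {i | μ j < μ i}) (M₀ := μ j) ?_ ?_ hMi hΔ hgap hsep hE
    · exact (Nat.lt_of_succ_le hK).trans_le (Nat.pow_le_pow_right (by norm_num) (by omega))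
    · intro t ht
      have : (q + 1) * (2 ^ m * n) ≤ q₀ * (2 ^ m * n) := Nat.mul_le_mul_right _ hlt
      have hts : t ≤ s := by rw [mem_Ioc] at ht; omega
      simp only [hM, if_pos hts, le_refl]
  -- In the critical round `j` may have both means; a beam outside `B` is worse by `Δ` than either,
  -- hence than their minimum.
  · refine measureReal_eliminated_le hm hn hmodel.measurable_reward (hmodel.indep s hs) hlaw hq hV
      hWV (B := {i | μ j < μ i}) (M₀ := min (μ j) μplus) ?_ ?_ hMi hΔ ?_ hsep hE
    · rw [heq]
      exact Nat.lt_of_succ_le hK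
    · intro t _
      simp only [hM, Function.update_self]
      split_ifs
      · exact min_le_left _ _
      · exact min_le_right _ _
    · intro i hi hiB
      rw [le_sub_iff_add_le]
      exact le_min (le_sub_iff_add_le.1 (hgap i hi hiB)) (le_sub_iff_add_le.1 (hgap' i hi))
  · refine measureReal_eliminated_le hm hn hmodel.measurable_reward (hmodel.indep s hs) hlaw hq hV
      hWV (B := ∅) (M₀ := μplus) (by simp) ?_ hMi hΔ (fun i hi _ => hgap' i hi) hsep hE
    intro t ht
    have : (q₀ + 1) * (2 ^ m * n) ≤ q * (2 ^ m * n) := Nat.mul_le_mul_right _ hgt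
    have hts : ¬ t ≤ s := by rw [mem_Ioc] at ht; omega
    simp only [hM, if_neg hts, Function.update_self, le_refl]

/-- If an event has conditional probability at most `δ` given each value of `f` in `D`, then it has
probability at most `δ` jointly with `f ∈ D`. -/
theorem measureReal_inter_preimage_le {Q : Measure Ω} [IsProbabilityMeasure Q] {f : Ω → ℕ}
    (hf : Measurable f) (D : Finset ℕ) (F : Set Ω) {δ : ℝ} (hδ : 0 ≤ δ)
    (h : ∀ s ∈ D, Q (f ⁻¹' {s}) ≠ 0 → (Q[|f ⁻¹' {s}]).real F ≤ δ) :
    Q.real (F ∩ f ⁻¹' D) ≤ δ := by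
  have hms : ∀ s, MeasurableSet (f ⁻¹' {s}) := fun s => hf (measurableSet_singleton s)
  calc Q.real (F ∩ f ⁻¹' D) ≤ Q.real (⋃ s ∈ D, f ⁻¹' {s} ∩ F) :=
        measureReal_mono (fun ω hω => Set.mem_biUnion hω.2 ⟨rfl, hω.1⟩) (measure_ne_top _ _)
    _ ≤ ∑ s ∈ D, Q.real (f ⁻¹' {s} ∩ F) := measureReal_biUnion_finset_le _ _
    _ ≤ ∑ s ∈ D, δ * Q.real (f ⁻¹' {s}) := by
        refine sum_le_sum fun s hs => ?_
        by_cases h0 : Q (f ⁻¹' {s}) = 0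
        · have : Q.real (f ⁻¹' {s} ∩ F) = 0 := by
            rw [measureReal_def, measure_mono_null Set.inter_subset_left h0, ENNReal.toReal_zero]
          rw [this]
          positivity
        · rw [measureReal_def (s := f ⁻¹' {s} ∩ F), ← cond_mul_eq_inter (hms s) F Q,
            ENNReal.toReal_mul]
          exact mul_le_mul_of_nonneg_right (h s hs h0) measureReal_nonneg
    _ = δ * Q.real (⋃ s ∈ D, f ⁻¹' {s}) := by
        rw [← mul_sum, measureReal_biUnion_finset]
        · intro s _ s' _ hne
          exact Set.disjoint_left.2 fun ω h h' => hne (h.symm.trans h')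
        · exact fun s _ => hms s
    _ ≤ δ := mul_le_of_le_one_right hδ measureReal_le_one

/-- Markov's inequality for an integer-valued variable with lower bound `a`. -/
theorem measureReal_ne_le_integral {Q : Measure Ω} [IsProbabilityMeasure Q] {f : Ω → ℕ}
    (hf : Measurable f) {a : ℤ} {b : ℕ} (h : ∀ᵐ ω ∂Q, a ≤ f ω ∧ f ω ≤ b) :
    Q.real {ω | (f ω : ℤ) ≠ a} ≤ ∫ ω, ((f ω : ℝ) - a) ∂Q := by
  have hmeas : MeasurableSet {ω | (f ω : ℤ) ≠ a} :=
    (MeasurableSet.of_discrete (s := {k : ℕ | (k : ℤ) ≠ a})).preimage hf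
  rw [← integral_indicator_one hmeas]
  refine integral_mono_ae ((integrable_const (1 : ℝ)).indicator hmeas) ?_ ?_
  · refine (Integrable.of_bound (C := (b : ℝ)) ?_ ?_).sub (integrable_const _)
    · exact (measurable_from_top.comp hf).aestronglyMeasurable
    · filter_upwards [h] with ω hω
      rw [Real.norm_natCast]
      exact_mod_cast hω.2
  · filter_upwards [h] with ω hω
    by_cases hne : (f ω : ℤ) = a
    · have : (f ω : ℝ) = a := by exact_mod_cast hne
      simp [hne, this]
    · have h1 : a + 1 ≤ f ω := by have := hω.1; omega
      have h2 : (a : ℝ) + 1 ≤ f ω := by exact_mod_cast h1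
      rw [Set.indicator_of_mem (by exact hne), Pi.one_apply]
      linarith

end Change

end SeqHalving

/-! ### The late change bound -/

theorem mainTheorem9 {Ω : Type*} [MeasurableSpace Ω] (P : Measure Ω) [IsProbabilityMeasure P]
    (m N K T : ℕ) (hm : 1 ≤ m) (hN : N = 2 ^ m) (hT : N * m ∣ T)
    -- means and variances of the beams before the change
    (μ : Fin N → ℝ) (v : Fin N → ℝ≥0)
    -- beam `j` changes; it is the `K`-th best before the change, and the best after it
    (j : Fin N) (μplus : ℝ) (vplus : ℝ≥0)
    (hK : #{i | μ j < μ i} + 1 = K) (hbest : ∀ i, i ≠ j → μ i < μplus)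
    -- bound on the sum of the variances of two different beams
    (V : ℝ) (hV : 0 < V)
    (hvar : ∀ i i', i ≠ i' → (v i : ℝ) + v i' ≤ V)
    (hvarplus : ∀ i, i ≠ j → (v i : ℝ) + vplus ≤ V)
    (tc : Ω → ℕ) (R : Fin N → ℕ → Ω → ℝ)
    (hmodel : SeqHalving.IsAbruptGaussian P T μ (Function.update μ j μplus)
      v (Function.update v j vplus) tc R)
    (hlate : P {ω | Real.logb 2 ((N : ℝ) / (2 * K)) < SeqHalving.roundOf N T (tc ω)} ≠ 0) :
    (P[|{ω | Real.logb 2 ((N : ℝ) / (2 * K)) < SeqHalving.roundOf N T (tc ω)}]).real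
        {ω | SeqHalving.Fails T (fun i t => R i t ω) j} ≤
      (∫ ω, ((SeqHalving.roundOf N T (tc ω) : ℝ) - SeqHalving.rStar N K)
        ∂(P[|{ω | (SeqHalving.rStar N K : ℝ) ≤ SeqHalving.roundOf N T (tc ω) ∧
          (SeqHalving.roundOf N T (tc ω) : ℝ) ≤ Real.logb 2 N}])) +
      2 * Real.logb 2 (2 * N * K) *
        Real.exp (-(1 / 2) * SeqHalving.deltaMin μ (Function.update μ j μplus) ^ 2 *
          T / (V * (N * Real.logb 2 N))) := by
  classical
  subst hN
  obtain ⟨n, rfl⟩ := hT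
  subst hK
  set K := #{i | μ j < μ i} + 1 with hK
  set A : Set Ω := {ω | Real.logb 2 (((2 ^ m : ℕ) : ℝ) / (2 * K)) <
    SeqHalving.roundOf (2 ^ m) (2 ^ m * m * n) (tc ω)} with hA
  have hlogN : Real.logb 2 ((2 ^ m : ℕ) : ℝ) = m := by
    rw [Nat.cast_pow, Nat.cast_ofNat, Real.logb_pow, Real.logb_self_eq_one (by norm_num), mul_one]
  have hrc : ∀ ω, SeqHalving.roundOf (2 ^ m) (2 ^ m * m * n) (tc ω) ≤ m := fun ω =>
    SeqHalving.roundOf_le hm (hmodel.tc_le ω)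
  have hmem : ∀ ω, ω ∈ A ↔ SeqHalving.rStar (2 ^ m) K ≤
      (SeqHalving.roundOf (2 ^ m) (2 ^ m * m * n) (tc ω) : ℤ) := fun ω => by
    rw [hA, Set.mem_ofPred_eq, SeqHalving.rStar, Int.add_one_le_iff, Int.floor_lt, Int.cast_natCast]
  -- Since `r_c` is an integer and never exceeds `log N`, both conditioning events coincide.
  have hAeq : {ω | (SeqHalving.rStar (2 ^ m) K : ℝ) ≤
      SeqHalving.roundOf (2 ^ m) (2 ^ m * m * n) (tc ω) ∧
      (SeqHalving.roundOf (2 ^ m) (2 ^ m * m * n) (tc ω) : ℝ) ≤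
        Real.logb 2 ((2 ^ m : ℕ) : ℝ)} = A := by
    ext ω
    rw [hmem, Set.mem_ofPred_eq, hlogN]
    constructor
    · exact fun h => by exact_mod_cast h.1
    · exact fun h => ⟨by exact_mod_cast h, by exact_mod_cast hrc ω⟩
  rw [hAeq]
  have hAmeas : MeasurableSet A :=
    hmodel.measurable_tc (MeasurableSet.of_discrete (s := {s | Real.logb 2
      (((2 ^ m : ℕ) : ℝ) / (2 * K)) < SeqHalving.roundOf (2 ^ m) (2 ^ m * m * n) s}))
  have : IsProbabilityMeasure (P[|A]) := cond_isProbabilityMeasure hlate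
  set Δ := SeqHalving.deltaMin μ (Function.update μ j μplus) with hΔ
  set δ := 2 * Real.logb 2 (2 * ((2 ^ m : ℕ) : ℝ) * K) * Real.exp (-(1 / 2) * Δ ^ 2 *
    ((2 ^ m * m * n : ℕ) : ℝ) / (V * (((2 ^ m : ℕ) : ℝ) * Real.logb 2 ((2 ^ m : ℕ) : ℝ)))) with hδdef
  have hδ : 2 * ((m : ℝ) + 1) * Real.exp (-(Δ ^ 2 * (n / (2 * V)))) ≤ δ := by
    have hm0 : (m : ℝ) ≠ 0 := by positivity
    have hexp : -(1 / 2) * Δ ^ 2 * ((2 ^ m * m * n : ℕ) : ℝ) /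
        (V * (((2 ^ m : ℕ) : ℝ) * Real.logb 2 ((2 ^ m : ℕ) : ℝ))) = -(Δ ^ 2 * (n / (2 * V))) := by
      rw [hlogN]
      push_cast
      field_simp
    rw [hδdef, hexp]
    have hlog : (m : ℝ) + 1 ≤ Real.logb 2 (2 * ((2 ^ m : ℕ) : ℝ) * K) := by
      rw [Real.le_logb_iff_rpow_le (by norm_num) (by positivity), Real.rpow_add_one (by norm_num),
        Real.rpow_natCast, mul_comm]
      push_cast
      have : (1 : ℝ) ≤ K := by exact_mod_cast Nat.le_add_left 1 _
      nlinarith [show (0 : ℝ) < 2 * 2 ^ m by positivity]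
    gcongr
  have hδ0 : 0 ≤ δ := le_trans (by positivity) hδ
  have hfail : ∀ s, P (tc ⁻¹' {s}) ≠ 0 →
      (SeqHalving.roundOf (2 ^ m) (2 ^ m * m * n) s : ℤ) = SeqHalving.rStar (2 ^ m) K →
      (P[|tc ⁻¹' {s}]).real {ω | SeqHalving.Fails (2 ^ m * m * n) (fun i t => R i t ω) j} ≤ δ := by
    intro s hs hround
    have : IsProbabilityMeasure (P[|tc ⁻¹' {s}]) := cond_isProbabilityMeasure hs
    refine le_trans ?_ hδ
    rcases le_or_gt (Real.exp (-(Δ ^ 2 * (n / (2 * V))))) (1 / 2) with hE | hE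
    · refine (SeqHalving.measureReal_cond_fails_le hm hbest hV hvar hvarplus hmodel hs hround
        hE).trans ?_
      nlinarith [Real.exp_pos (-(Δ ^ 2 * (n / (2 * V))))]
    -- Here `2 (m + 1) E > m + 1`, so the bound is trivial.
    · refine measureReal_le_one.trans ?_
      have : (1 : ℝ) ≤ m := by exact_mod_cast hm
      nlinarith
  -- For `K > N / 2`, `r* = 0` and `D` is empty; the Markov term alone is then at least 1.
  set D : Finset ℕ := {s ∈ range (2 ^ m * m * n + 1) |
    (SeqHalving.roundOf (2 ^ m) (2 ^ m * m * n) s : ℤ) = SeqHalving.rStar (2 ^ m) K} with hD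
  have hcritical := SeqHalving.measureReal_inter_preimage_le (Q := P[|A]) hmodel.measurable_tc D
    {ω | SeqHalving.Fails (2 ^ m * m * n) (fun i t => R i t ω) j} hδ0 (fun s hs h0 => by
      have hround := (mem_filter.1 hs).2
      have hsub : tc ⁻¹' {s} ⊆ A := fun ω hω => by
        have hω' : tc ω = s := hω
        rw [hmem, hω', hround]
      rw [cond_cond_eq_cond_inter hAmeas (hmodel.measurable_tc (measurableSet_singleton s)),
        Set.inter_eq_self_of_subset_right hsub]
      exact hfail s (fun h => h0 (cond_absolutelyContinuous h)) hround)
  have hother := SeqHalving.measureReal_ne_le_integral (Q := P[|A])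
    (f := fun ω => SeqHalving.roundOf (2 ^ m) (2 ^ m * m * n) (tc ω))
    ((measurable_from_top (f := SeqHalving.roundOf (2 ^ m) (2 ^ m * m * n))).comp
      hmodel.measurable_tc) (a := SeqHalving.rStar (2 ^ m) K) (b := m) (by
      filter_upwards [ae_cond_mem hAmeas] with ω hω
      exact ⟨(hmem ω).1 hω, hrc ω⟩)
  refine le_trans (measureReal_mono (fun ω hω => ?_) (measure_ne_top _ _))
    ((measureReal_union_le _ _).trans (add_le_add hother hcritical))
  by_cases h : (SeqHalving.roundOf (2 ^ m) (2 ^ m * m * n) (tc ω) : ℤ) = SeqHalving.rStar (2 ^ m) K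
  · exact .inr ⟨hω, mem_filter.2 ⟨mem_range.2 (Nat.lt_succ_of_le (hmodel.tc_le ω)), h⟩⟩
  · exact .inl h
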